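/- Let $\mathcal K^n$ be the family of nonempty compact convex subsets of $\mathbb R^n$ (interior possibly empty), with the Hausdorff metric. For a linear subspace $H\subseteq\mathbb R^n$ let $R_H$ be the orthogonal reflection $x\mapsto x-2P_{H^\perp}x$; a set $K$ is $H$-symmetric if $R_HK=K$. A symmetrization $\diamondsuit$ on $\mathcal K^n$ assigns to every linear subspace $H$ of $\mathbb R^n$ a map $\diamondsuit_H$ from $\mathcal K^n$ to the $H$-symmetric members of $\mathcal K^n$. Let $\mathcal F$ be the family of all symmetrizations on $\mathcal K^n$ such that for every $H$: (monotonicity) $K\subseteq L$ implies $\diamondsuit_HK\subseteq\diamondsuit_HL$; (invariance for $H$-symmetric sets) $\diamondsuit_HK=K$ whenever $R_HK=K$; ($H^\perp$-translation invariance for $H$-symmetric sets) $\diamondsuit_H(K+x)=K$ whenever $R_HK=K$ and $x\in H^\perp$. A sequence $(H_m)_{m\in\mathbb N}$ of linear subspaces of $\mathbb R^n$ is weakly-universal for $\diamondsuit$ in $\mathcal K^n$ if for every $k\in\mathbb N$ and every $K\in\mathcal K^n$ the sequence $(\diamondsuit_{H_m}\cdots\diamondsuit_{H_{k+1}}\diamondsuit_{H_k}K)_{m\ge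 k}$ converges to a closed Euclidean ball, whose radius $r(K,k)\ge 0$ may depend on $K$ and on the starting index $k$ (a ball of radius $0$ is a point). It is weakly-universal for $\diamondsuit$ on bodies if the same holds for all $k$ and all $K\in\mathcal K^n$ with nonempty interior, with $r(K,k)>0$. **Theorem.** Let $\diamondsuit,\spadesuit\in\mathcal F$ and let $(H_m)$ be a sequence of linear subspaces of $\mathbb R^n$. Then $(H_m)$ is weakly-universal for $\diamondsuit$ in $\mathcal K^n$ if and only if it is weakly-universal for $\spadesuit$ in $\mathcal K^n$. Likewise, $(H_m)$ is weakly-universal for $\diamondsuit$ on bodies if and only if it is weakly-universal for $\spadesuit$ on bodies. -/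

import Mathlib

open Filter Topology

/-- `n`-dimensional Euclidean space. -/
abbrev Euc (n : ℕ) : Type := EuclideanSpace ℝ (Fin n)

/-- `𝒦ⁿ`: the nonempty compact convex subsets of `ℝⁿ`. Its metric is the Hausdorff distance. The
interior may be empty. -/
abbrev ConvexCompact (n : ℕ) : Type := ConvexBody (Euc n)

/-- `K` is symmetric with respect to the linear subspace `H`: `R_H K = K`, where
`R_H` is the orthogonal reflection `x ↦ x - 2 P_{H^⊥} x`. -/
def IsSymmWrt {n : ℕ} (H : Submodule ℝ (Euc n)) (K : ConvexCompact n) : Prop :=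
  H.reflection '' (K : Set (Euc n)) = (K : Set (Euc n))

/-- The translate `K + x`. -/
def translateBody {n : ℕ} (K : ConvexCompact n) (x : Euc n) : ConvexCompact n where
  carrier := (fun y => y + x) '' (K : Set (Euc n))
  convex' := by simpa only [add_comm] using K.convex.translate x
  isCompact' := K.isCompact.image (by fun_prop)
  nonempty' := K.nonempty.image _

/-- The closed Euclidean ball with centre `c` and radius `r ≥ 0` (a point if `r = 0`). -/
def ballBody {n : ℕ} (c : Euc n) (r : ℝ) (hr : 0 ≤ r) : ConvexCompact n where
  carrier := Metric.closedBall c r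
  convex' := convex_closedBall c r
  isCompact' := isCompact_closedBall c r
  nonempty' := Metric.nonempty_closedBall.2 hr

/-- A symmetrization on `𝒦ⁿ`: for every linear subspace `H` of `ℝⁿ`, a map `◇_H` from `𝒦ⁿ` to
the `H`-symmetric members of `𝒦ⁿ`. -/
structure Symmetrization (n : ℕ) where
  /-- The map `◇_H`. -/
  sym : Submodule ℝ (Euc n) → ConvexCompact n → ConvexCompact n
  /-- The values of `◇_H` are `H`-symmetric. -/
  isSymmWrt_sym : ∀ H K, IsSymmWrt H (sym H K)

namespace Symmetrization

/-- Monotonicity. -/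
def IsMonotone {n : ℕ} (D : Symmetrization n) : Prop :=
  ∀ (H : Submodule ℝ (Euc n)) (K L : ConvexCompact n),
    (K : Set (Euc n)) ⊆ L → (D.sym H K : Set (Euc n)) ⊆ D.sym H L

/-- `H^⊥`-translation invariance for `H`-symmetric sets. -/
def IsTranslationInvariant {n : ℕ} (D : Symmetrization n) : Prop :=
  ∀ (H : Submodule ℝ (Euc n)) (K : ConvexCompact n), IsSymmWrt H K →
    ∀ x ∈ Hᗮ, D.sym H (translateBody K x) = K

/-- Invariance for `H`-symmetric sets. -/
def IsInvariant {n : ℕ} (D : Symmetrization n) : Prop :=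
  ∀ (H : Submodule ℝ (Euc n)) (K : ConvexCompact n), IsSymmWrt H K → D.sym H K = K

/-- The family `ℱ` of all symmetrizations on `𝒦ⁿ` that are monotone, invariant for `H`-symmetric
sets, and `H^⊥`-translation invariant for `H`-symmetric sets. -/
def familyF (n : ℕ) : Set (Symmetrization n) :=
  {D | D.IsMonotone ∧ D.IsTranslationInvariant ∧ D.IsInvariant}

/-- The truncated process started at index `k`:
`D.process H k K j = ◇_{H_{k+j}} ⋯ ◇_{H_{k+1}} ◇_{H_k} K`. -/
def process {n : ℕ} (D : Symmetrization n) (H : ℕ → Submodule ℝ (Euc n)) (k : ℕ)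
    (K : ConvexCompact n) : ℕ → ConvexCompact n
  | 0 => D.sym (H k) K
  | j + 1 => D.sym (H (k + (j + 1))) (D.process H k K j)

/-- `(H_m)` is weakly-universal for `D` in `𝒦ⁿ`: for every starting index `k` and every
`K ∈ 𝒦ⁿ`, the process started at `k` converges to a ball, with a radius that may depend on `K`
and `k`. As `K` may have empty interior (for instance, be a point), radius `0` is allowed. -/
def WeaklyUniversal {n : ℕ} (D : Symmetrization n) (H : ℕ → Submodule ℝ (Euc n)) : Prop :=
  ∀ (k : ℕ) (K : ConvexCompact n), ∃ (c : Euc n) (r : ℝ) (hr : 0 ≤ r),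
    Tendsto (D.process H k K) atTop (𝓝 (ballBody c r hr))

/-- `(H_m)` is weakly-universal for `D` on the members of `𝒦ⁿ` with nonempty interior: for every
starting index `k` and every such `K`, the process started at `k` converges to a ball of positive
radius, which may depend on `K` and `k`. -/
def WeaklyUniversalOnBodies {n : ℕ} (D : Symmetrization n) (H : ℕ → Submodule ℝ (Euc n)) : Prop :=
  ∀ (k : ℕ) (K : ConvexCompact n), (interior (K : Set (Euc n))).Nonempty →
    ∃ (c : Euc n) (r : ℝ) (hr : 0 < r),
      Tendsto (D.process H k K) atTop (𝓝 (ballBody c r hr.le))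

end Symmetrization

/-! ### Steiner symmetrization along coordinates and a volume inequality. -/

section Steiner

open MeasureTheory

/-! Every implication is routed through Minkowski symmetrization M. It dominates the family: D_H K ⊆
M_H K for all D in ℱ (`Symmetrization.sym_subset_minkowski`), and it preserves mean width. From
below, D_H K contains (a + R_H b)/2 whenever a, b ∈ K and a - b ∈ H^⊥, which forces D_H not to
decrease volume (`volume_le_volume_sym`).

From D to M on bodies: let Q_j be the M-process of K. Continuing from Q_j with D instead of M gives
a limit ball B_j of volume at least that of Q_j. Since D ⊆ M, the later Q_m nearly contain B_j, and
the B_j increase to a ball B. Thus Q_m nearly contains B but has no larger volume, so Q_m → B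
(`tendsto_ballBody_of_inner_balls`).

From bodies to all convex sets, for M: adding a unit ball to K adds the same ball to every term of
its M-process.

From M to S: dually, let Q_j be the S-process and continue from Q_j with M. The limit balls B_j have
the mean width of Q_j, decrease to a ball B, and each nearly contains the later Q_m. Thus Q_m is
nearly inside B but has no smaller mean width, so Q_m → B (`tendsto_ballBody_of_outer_balls`).

Monotonicity of volume also makes the limit radius positive when K has interior and n > 0. -/

theorem ofReal_half_add_lt_volume {A B C : Set ℝ} (hA : MeasurableSet A) (hB : MeasurableSet B)
    {a b : ℝ} (ha : 0 ≤ a) (hb : 0 ≤ b) (hAa : ENNReal.ofReal a < volume A)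
    (hBb : ENNReal.ofReal b < volume B) (h : ∀ s ∈ A, ∀ t ∈ B, (s - t) / 2 ∈ C) :
    ENNReal.ofReal ((a + b) / 2) < volume C := by
  obtain ⟨A', hA'A, hA', haA'⟩ := hA.exists_lt_isCompact hAa
  obtain ⟨B', hB'B, hB', hbB'⟩ := hB.exists_lt_isCompact hBb
  have neA : A'.Nonempty := by
    rw [Set.nonempty_iff_ne_empty]; rintro rfl; simp at haA'
  have neB : B'.Nonempty := by
    rw [Set.nonempty_iff_ne_empty]; rintro rfl; simp at hbB'
  obtain ⟨s, hs, hsmax⟩ := hA'.exists_isGreatest neA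
  obtain ⟨t, ht, htmax⟩ := hB'.exists_isGreatest neB
  -- One-dimensional Brunn–Minkowski: X = (A' - t)/2 lies to the left of (s - t)/2 and Y = (s -
  -- B')/2 to its right, so their lengths add up inside C.
  set X : Set ℝ := (fun c => 2 * c) ⁻¹' ((fun c => c + t) ⁻¹' A') with hX
  set Y : Set ℝ := (fun c => (-2) * c) ⁻¹' ((fun c => c + s) ⁻¹' B') with hY
  have hXC : X ⊆ C := fun c hc => by
    have := h _ (hA'A hc) t (hB'B ht)
    simpa using this
  have hYC : Y ⊆ C := fun c hc => by
    have := h s (hA'A hs) _ (hB'B hc)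
    convert this using 1
    ring
  have hYm : MeasurableSet Y := by
    apply measurable_const_mul _ (measurable_add_const _ hB'.measurableSet)
  have hvX : volume X = ENNReal.ofReal (1 / 2) * volume A' := by
    rw [hX, Real.volume_preimage_mul_left (by norm_num), measure_preimage_add_right]
    norm_num [abs_of_pos]
  have hvY : volume Y = ENNReal.ofReal (1 / 2) * volume B' := by
    rw [hY, Real.volume_preimage_mul_left (by norm_num), measure_preimage_add_right]
    norm_num [abs_of_pos]
  have hd : AEDisjoint volume X Y := by
    refine measure_mono_null (t := {(s - t) / 2}) ?_ (by simp)
    rintro c ⟨h1, h2⟩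
    have h1' := hsmax h1
    have h2' := htmax h2
    simp only [Set.mem_singleton_iff] at *
    linarith
  calc ENNReal.ofReal ((a + b) / 2)
      = ENNReal.ofReal (1 / 2) * (ENNReal.ofReal a + ENNReal.ofReal b) := by
        rw [← ENNReal.ofReal_add ha hb, ← ENNReal.ofReal_mul (by norm_num)]
        congr 1; ring
    _ < ENNReal.ofReal (1 / 2) * (volume A' + volume B') := by
        refine ENNReal.mul_lt_mul_right (by simp) (by simp) ?_
        exact ENNReal.add_lt_add haA' hbB'
    _ = volume (X ∪ Y) := by
        rw [measure_union₀ hYm.nullMeasurableSet hd, hvX, hvY, mul_add]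
    _ ≤ volume C := measure_mono (Set.union_subset hXC hYC)

theorem volume_two_mul_abs_lt (l : ENNReal) :
    volume {t : ℝ | ENNReal.ofReal (2 * |t|) < l} = l := by
  induction l with
  | top => simp [ENNReal.mul_lt_top]
  | coe l =>
    have : {t : ℝ | ENNReal.ofReal (2 * |t|) < (l : ENNReal)} = Set.Ioo (-(l / 2 : ℝ)) (l / 2) := by
      ext t
      rw [Set.mem_ofPred_eq, ← ENNReal.ofReal_coe_nnreal, ENNReal.ofReal_lt_ofReal_iff_of_nonneg
        (by positivity), Set.mem_Ioo, ← abs_lt, lt_div_iff₀ (by norm_num), mul_comm]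
    rw [this, Real.volume_Ioo]
    ring_nf
    simp

variable {ι : Type*} [Fintype ι] [DecidableEq ι]

/-- The (open) Steiner symmetral of a set in the direction of the `i`-th coordinate axis. -/
def coordSteiner (i : ι) (A : Set (ι → ℝ)) : Set (ι → ℝ) :=
  {x | ENNReal.ofReal (2 * |x i|) < volume {t | Function.update x i t ∈ A}}

omit [Fintype ι] in
theorem lintegral_indicator_update (i : ι) {A : Set (ι → ℝ)} (hA : MeasurableSet A) (x : ι → ℝ) :
    ∫⁻ t, A.indicator 1 (Function.update x i t) = volume {t | Function.update x i t ∈ A} := by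
  have hm : MeasurableSet {t | Function.update x i t ∈ A} := measurable_update x hA
  rw [← lintegral_indicator_one hm]
  rfl

omit [Fintype ι] in
theorem measurableSet_coordSteiner (i : ι) {A : Set (ι → ℝ)} (hA : MeasurableSet A) :
    MeasurableSet (coordSteiner i A) := by
  have hm : Measurable fun x : ι → ℝ => volume {t | Function.update x i t ∈ A} := by
    have := (measurable_const.indicator hA (f := (1 : (ι → ℝ) → ENNReal))).lmarginal
      (s := {i}) (fun _ => (volume : Measure ℝ))
    rw [lmarginal_singleton] at this
    simpa only [lintegral_indicator_update i hA] using this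
  exact measurableSet_lt (by fun_prop) hm

/-- Fubini: each fibre in direction i is replaced by a centred interval of the same length. -/
theorem volume_coordSteiner (i : ι) {A : Set (ι → ℝ)} (hA : MeasurableSet A) :
    volume (coordSteiner i A) = volume A := by
  have hS := measurableSet_coordSteiner i hA
  rw [← lintegral_indicator_one hS, ← lintegral_indicator_one hA]
  refine lintegral_eq_of_lmarginal_eq (μ := fun _ => (volume : Measure ℝ)) {i}
    (measurable_const.indicator hS) (measurable_const.indicator hA) ?_
  rw [lmarginal_singleton, lmarginal_singleton]
  funext x
  rw [lintegral_indicator_update i hA, lintegral_indicator_update i hS]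
  simp only [coordSteiner, Set.mem_ofPred_eq, Function.update_self, Function.update_idem]
  exact volume_two_mul_abs_lt _

/-- Steiner symmetrizing both sets in one coordinate of J keeps their volumes and turns the
hypothesis for J into the hypothesis with that coordinate removed; when J is empty it says A ⊆ C.
For J the coordinates of H^⊥, the point in the hypothesis is (a + R_H b)/2. -/
theorem volume_le_of_coord_half_sub_mem (J : Finset ι) :
    ∀ {A C : Set (ι → ℝ)}, MeasurableSet A → MeasurableSet C →
      (∀ a ∈ A, ∀ b ∈ A, (∀ i ∉ J, a i = b i) →
        (fun i => if i ∈ J then (a i - b i) / 2 else a i) ∈ C) → volume A ≤ volume C := by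
  induction J using Finset.induction_on with
  | empty =>
    intro A C _ _ h
    exact measure_mono fun a ha => by simpa using h a ha a ha
  | insert i J hi ih =>
    intro A C hA hC h
    rw [← volume_coordSteiner i hA, ← volume_coordSteiner i hC]
    refine ih (measurableSet_coordSteiner i hA) (measurableSet_coordSteiner i hC) ?_
    intro a ha b hb hab
    have habi := hab i hi
    -- The fibres of A through a and b are longer than 2|a i| and 2|b i|, so the fibre of C is
    -- longer than |a i| + |b i|, which is 2|a i| because a i = b i.
    have key := ofReal_half_add_lt_volume (measurable_update a hA) (measurable_update b hA)
      (by positivity) (by positivity) ha hb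
      (C := {t | Function.update (fun k => if k ∈ J then (a k - b k) / 2 else a k) i t ∈ C}) ?_
    · simp only [coordSteiner, Set.mem_ofPred_eq, if_neg hi]
      convert key using 2
      rw [habi]; ring
    · intro s hs t ht
      have := h _ hs _ ht fun k hk => by
        have hki : k ≠ i := fun e => hk (by simp [e])
        have hkJ : k ∉ J := fun e => hk (by simp [e])
        simp [Function.update_of_ne hki, hab k hkJ]
      simp only [Set.mem_ofPred_eq]
      convert this using 1
      funext k
      by_cases hki : k = i
      · subst hki; simp
      · simp [hki]

end Steiner

/-! ### Support functions and the Hausdorff metric. -/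

section SupportFunction

open scoped RealInnerProductSpace Pointwise

variable {n : ℕ}

/-- The support function `h_K(u) = sup_{x ∈ K} ⟪u, x⟫`. -/
noncomputable def supportFn (K : ConvexCompact n) (u : Euc n) : ℝ :=
  sSup ((fun x => ⟪u, x⟫) '' (K : Set (Euc n)))

theorem exists_inner_eq_supportFn (K : ConvexCompact n) (u : Euc n) :
    ∃ x ∈ K, ⟪u, x⟫ = supportFn K u := by
  have hc : IsCompact ((fun x => ⟪u, x⟫) '' (K : Set (Euc n))) :=
    K.isCompact.image (by fun_prop)
  obtain ⟨x, hx, h⟩ := hc.sSup_mem (K.nonempty.image _)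
  exact ⟨x, hx, h⟩

theorem inner_le_supportFn {K : ConvexCompact n} {x : Euc n} (hx : x ∈ K) (u : Euc n) :
    ⟪u, x⟫ ≤ supportFn K u :=
  le_csSup (K.isCompact.image (by fun_prop)).bddAbove ⟨x, hx, rfl⟩

theorem supportFn_le {K : ConvexCompact n} {u : Euc n} {a : ℝ} (h : ∀ x ∈ K, ⟪u, x⟫ ≤ a) :
    supportFn K u ≤ a := by
  obtain ⟨x, hx, e⟩ := exists_inner_eq_supportFn K u
  exact e ▸ h x hx

theorem supportFn_mono {K L : ConvexCompact n} (h : (K : Set (Euc n)) ⊆ L) (u : Euc n) :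
    supportFn K u ≤ supportFn L u :=
  supportFn_le fun _ hx => inner_le_supportFn (h hx) u

/-- Hahn–Banach separation, with the functional represented by a vector. -/
theorem mem_of_forall_inner_le_supportFn {K : ConvexCompact n} {x : Euc n}
    (h : ∀ u, ⟪u, x⟫ ≤ supportFn K u) : x ∈ K := by
  by_contra hx
  obtain ⟨f, a, h1, h2⟩ := geometric_hahn_banach_closed_point K.convex K.isClosed hx
  obtain ⟨y, hy, e⟩ := exists_inner_eq_supportFn K ((InnerProductSpace.toDual ℝ (Euc n)).symm f)
  have := h ((InnerProductSpace.toDual ℝ (Euc n)).symm f)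
  rw [← e, InnerProductSpace.toDual_symm_apply, InnerProductSpace.toDual_symm_apply] at this
  linarith [h1 y hy]

theorem subset_of_supportFn_le {K L : ConvexCompact n}
    (h : ∀ u, supportFn K u ≤ supportFn L u) : (K : Set (Euc n)) ⊆ L := fun _ hx =>
  mem_of_forall_inner_le_supportFn fun u => (inner_le_supportFn hx u).trans (h u)

theorem eq_of_supportFn_eq {K L : ConvexCompact n}
    (h : ∀ u, supportFn K u = supportFn L u) : K = L :=
  ConvexBody.ext ((subset_of_supportFn_le fun u => (h u).le).antisymm
    (subset_of_supportFn_le fun u => (h u).ge))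

theorem supportFn_ballBody (c : Euc n) {r : ℝ} (hr : 0 ≤ r) (u : Euc n) :
    supportFn (ballBody c r hr) u = ⟪u, c⟫ + r * ‖u‖ := by
  apply le_antisymm
  · refine supportFn_le fun x hx => ?_
    have hx' : ‖x - c‖ ≤ r := mem_closedBall_iff_norm.1 hx
    have := real_inner_le_norm u (x - c)
    rw [inner_sub_right] at this
    nlinarith [norm_nonneg u]
  · rcases eq_or_ne u 0 with rfl | hu
    · have hc : c ∈ ballBody c r hr := Metric.mem_closedBall_self hr
      simpa using inner_le_supportFn hc (0 : Euc n)
    · have hu' : 0 < ‖u‖ := norm_pos_iff.2 hu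
      have hx : c + (r / ‖u‖) • u ∈ ballBody c r hr := by
        refine mem_closedBall_iff_norm.2 ?_
        rw [add_sub_cancel_left, norm_smul, Real.norm_of_nonneg (by positivity)]
        field_simp
        rfl
      have := inner_le_supportFn hx u
      rw [inner_add_right, inner_smul_right, real_inner_self_eq_norm_sq] at this
      have e : r / ‖u‖ * ‖u‖ ^ 2 = r * ‖u‖ := by field_simp
      linarith

theorem supportFn_add (K L : ConvexCompact n) (u : Euc n) :
    supportFn (K + L) u = supportFn K u + supportFn L u := by
  apply le_antisymm
  · refine supportFn_le fun z hz => ?_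
    obtain ⟨x, hx, y, hy, rfl⟩ := Set.mem_add.1 (show z ∈ (K : Set (Euc n)) + L from hz)
    rw [inner_add_right]
    exact add_le_add (inner_le_supportFn hx u) (inner_le_supportFn hy u)
  · obtain ⟨x, hx, ex⟩ := exists_inner_eq_supportFn K u
    obtain ⟨y, hy, ey⟩ := exists_inner_eq_supportFn L u
    rw [← ex, ← ey, ← inner_add_right]
    exact inner_le_supportFn (show x + y ∈ K + L from Set.add_mem_add hx hy) u

theorem supportFn_smul (K : ConvexCompact n) {a : ℝ} (ha : 0 ≤ a) (u : Euc n) :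
    supportFn (a • K) u = a * supportFn K u := by
  apply le_antisymm
  · refine supportFn_le fun z hz => ?_
    obtain ⟨x, hx, rfl⟩ := Set.mem_smul_set.1 (show z ∈ a • (K : Set (Euc n)) from hz)
    rw [inner_smul_right]
    exact mul_le_mul_of_nonneg_left (inner_le_supportFn hx u) ha
  · obtain ⟨x, hx, ex⟩ := exists_inner_eq_supportFn K u
    rw [← ex, ← inner_smul_right]
    exact inner_le_supportFn (show a • x ∈ a • K from Set.smul_mem_smul_set hx) u

theorem abs_supportFn_sub_le (K L : ConvexCompact n) (u : Euc n) :
    |supportFn K u - supportFn L u| ≤ dist K L * ‖u‖ := by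
  have main : ∀ K L : ConvexCompact n, supportFn K u ≤ supportFn L u + dist K L * ‖u‖ := by
    intro K L
    refine supportFn_le fun x hx => ?_
    obtain ⟨y, hy, hxy⟩ := L.isCompact.exists_infDist_eq_dist L.nonempty x
    have h1 : dist x y ≤ dist K L := by
      rw [← hxy]
      exact Metric.infDist_le_hausdorffDist_of_mem hx ConvexBody.hausdorffEDist_ne_top
    have h2 := inner_le_supportFn (K := L) hy u
    have h3 := real_inner_le_norm u (x - y)
    rw [inner_sub_right, ← dist_eq_norm] at h3
    nlinarith [norm_nonneg u]
  rw [abs_le]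
  have := main L K
  rw [dist_comm] at this
  constructor <;> linarith [main K L]

theorem dist_le_of_abs_supportFn_sub_le {K L : ConvexCompact n} {ε : ℝ} (hε : 0 ≤ ε)
    (h : ∀ u, |supportFn K u - supportFn L u| ≤ ε * ‖u‖) : dist K L ≤ ε := by
  have main : ∀ K L : ConvexCompact n, (∀ u, supportFn K u ≤ supportFn L u + ε * ‖u‖) →
      ∀ x ∈ (K : Set (Euc n)), ∃ y ∈ (L : Set (Euc n)), dist x y ≤ ε := by
    intro K L h x hx
    -- The bound on support functions says that K lies in the parallel body L + εB.
    have : x ∈ L + ballBody 0 ε hε := mem_of_forall_inner_le_supportFn fun u => by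
      rw [supportFn_add, supportFn_ballBody, inner_zero_right, zero_add]
      exact (inner_le_supportFn hx u).trans (h u)
    obtain ⟨y, hy, z, hz, rfl⟩ := Set.mem_add.1 (show x ∈ (L : Set (Euc n)) + _ from this)
    refine ⟨y, hy, ?_⟩
    have hz' : dist z 0 ≤ ε := hz
    simpa [dist_eq_norm] using hz'
  refine Metric.hausdorffDist_le_of_mem_dist hε (main K L fun u => ?_) (main L K fun u => ?_)
  · linarith [(abs_le.1 (h u)).2]
  · linarith [(abs_le.1 (h u)).1]

/-- Support functions are used instead of inclusions of balls because r - ε may be negative; the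
lower bound keeps its meaning then. -/
theorem tendsto_ballBody_iff {P : ℕ → ConvexCompact n} {c : Euc n} {r : ℝ} (hr : 0 ≤ r) :
    Tendsto P atTop (𝓝 (ballBody c r hr)) ↔ ∀ ε > 0, ∀ᶠ m in atTop, ∀ u,
      ⟪u, c⟫ + (r - ε) * ‖u‖ ≤ supportFn (P m) u ∧
        supportFn (P m) u ≤ ⟪u, c⟫ + (r + ε) * ‖u‖ := by
  constructor
  · intro h ε hε
    filter_upwards [Metric.tendsto_nhds.1 h ε hε] with m hm u
    have h1 := abs_supportFn_sub_le (P m) (ballBody c r hr) u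
    rw [supportFn_ballBody, abs_le] at h1
    have := mul_le_mul_of_nonneg_right hm.le (norm_nonneg u)
    constructor <;> linarith
  · intro h
    refine Metric.tendsto_nhds.2 fun ε hε => ?_
    filter_upwards [h (ε / 2) (by positivity)] with m hm
    refine (dist_le_of_abs_supportFn_sub_le (ε := ε / 2) (by positivity) fun u => ?_).trans_lt
      (by linarith)
    rw [supportFn_ballBody, abs_le]
    constructor <;> linarith [(hm u).1, (hm u).2]

theorem closedBall_subset_iff {K : ConvexCompact n} {c : Euc n} {r : ℝ} (hr : 0 ≤ r) :
    Metric.closedBall c r ⊆ (K : Set (Euc n)) ↔ ∀ u, ⟪u, c⟫ + r * ‖u‖ ≤ supportFn K u := by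
  constructor
  · intro h u
    rw [← supportFn_ballBody c hr]
    exact supportFn_mono h u
  · intro h
    refine subset_of_supportFn_le (K := ballBody c r hr) fun u => ?_
    rw [supportFn_ballBody]
    exact h u

theorem subset_closedBall_iff {K : ConvexCompact n} {c : Euc n} {r : ℝ} (hr : 0 ≤ r) :
    (K : Set (Euc n)) ⊆ Metric.closedBall c r ↔ ∀ u, supportFn K u ≤ ⟪u, c⟫ + r * ‖u‖ := by
  constructor
  · intro h u
    rw [← supportFn_ballBody c hr]
    exact supportFn_mono (L := ballBody c r hr) h u
  · intro h
    refine subset_of_supportFn_le (L := ballBody c r hr) fun u => ?_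
    rw [supportFn_ballBody]
    exact h u

theorem supportFn_sub_le {K : ConvexCompact n} {R : ℝ}
    (hK : (K : Set (Euc n)) ⊆ Metric.closedBall 0 R) (u v : Euc n) :
    supportFn K u - supportFn K v ≤ R * ‖u - v‖ := by
  rw [sub_le_iff_le_add]
  refine supportFn_le fun x hx => ?_
  have h1 := inner_le_supportFn hx v
  have h2 := real_inner_le_norm (u - v) x
  have h3 : ‖x‖ ≤ R := mem_closedBall_zero_iff.1 (hK hx)
  rw [inner_sub_left] at h2
  nlinarith [norm_nonneg (u - v)]

theorem exists_subset_closedBall (K : ConvexCompact n) :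
    ∃ R, 0 < R ∧ (K : Set (Euc n)) ⊆ Metric.closedBall 0 R := by
  obtain ⟨R, hR, h⟩ := K.isBounded.exists_pos_norm_le
  exact ⟨R, hR, fun x hx => mem_closedBall_zero_iff.2 (h x hx)⟩

theorem continuous_supportFn (K : ConvexCompact n) : Continuous (supportFn K) := by
  obtain ⟨R, hR, hK⟩ := exists_subset_closedBall K
  refine (LipschitzWith.of_le_add_mul ⟨R, hR.le⟩ fun u v => ?_).continuous
  have := supportFn_sub_le hK u v
  rw [dist_eq_norm]
  change _ ≤ _ + R * _
  linarith

end SupportFunction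

/-! ### Minkowski symmetrization. -/

section Minkowski

open scoped RealInnerProductSpace Pointwise

variable {n : ℕ}

theorem inner_reflection_comm (H : Submodule ℝ (Euc n)) (u x : Euc n) :
    ⟪u, H.reflection x⟫ = ⟪H.reflection u, x⟫ := by
  rw [← H.reflection.inner_map_map, H.reflection_reflection]

/-- The image of a convex body under the reflection in `H`. -/
noncomputable def reflectBody (H : Submodule ℝ (Euc n)) (K : ConvexCompact n) :
    ConvexCompact n where
  carrier := H.reflection '' (K : Set (Euc n))
  convex' := K.convex.linear_image H.reflection.toLinearEquiv.toLinearMap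
  isCompact' := K.isCompact.image H.reflection.continuous
  nonempty' := K.nonempty.image _

theorem supportFn_reflectBody (H : Submodule ℝ (Euc n)) (K : ConvexCompact n) (u : Euc n) :
    supportFn (reflectBody H K) u = supportFn K (H.reflection u) := by
  apply le_antisymm
  · refine supportFn_le fun z hz => ?_
    obtain ⟨y, hy, rfl⟩ := hz
    rw [inner_reflection_comm]
    exact inner_le_supportFn hy _
  · obtain ⟨y, hy, ey⟩ := exists_inner_eq_supportFn K (H.reflection u)
    rw [← ey, ← inner_reflection_comm]
    exact inner_le_supportFn (show H.reflection y ∈ reflectBody H K from ⟨y, hy, rfl⟩) u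

theorem isSymmWrt_iff_reflectBody {H : Submodule ℝ (Euc n)} {K : ConvexCompact n} :
    IsSymmWrt H K ↔ reflectBody H K = K :=
  ⟨fun h => ConvexBody.ext h, fun h => congrArg (fun L : ConvexCompact n => (L : Set (Euc n))) h⟩

theorem isSymmWrt_iff_supportFn {H : Submodule ℝ (Euc n)} {K : ConvexCompact n} :
    IsSymmWrt H K ↔ ∀ u, supportFn K (H.reflection u) = supportFn K u := by
  rw [isSymmWrt_iff_reflectBody]
  refine ⟨fun h u => by rw [← supportFn_reflectBody, h], fun h => eq_of_supportFn_eq fun u => ?_⟩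
  rw [supportFn_reflectBody, h]

theorem supportFn_half_add_reflectBody (H : Submodule ℝ (Euc n)) (K : ConvexCompact n)
    (u : Euc n) : supportFn ((1 / 2 : ℝ) • (K + reflectBody H K)) u =
      (supportFn K u + supportFn K (H.reflection u)) / 2 := by
  rw [supportFn_smul _ (by norm_num), supportFn_add, supportFn_reflectBody]
  ring

/-- Minkowski symmetrization `K ↦ (K + R_H K) / 2`. -/
noncomputable def minkowskiSymmetrization (n : ℕ) : Symmetrization n where
  sym H K := (1 / 2 : ℝ) • (K + reflectBody H K)
  isSymmWrt_sym H K := isSymmWrt_iff_supportFn.2 fun u => by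
    rw [supportFn_half_add_reflectBody, supportFn_half_add_reflectBody,
      H.reflection_reflection, add_comm]

theorem supportFn_minkowski (H : Submodule ℝ (Euc n)) (K : ConvexCompact n) (u : Euc n) :
    supportFn ((minkowskiSymmetrization n).sym H K) u =
      (supportFn K u + supportFn K (H.reflection u)) / 2 :=
  supportFn_half_add_reflectBody H K u

theorem isMonotone_minkowski : (minkowskiSymmetrization n).IsMonotone := fun H K L h => by
  refine subset_of_supportFn_le fun u => ?_
  rw [supportFn_minkowski, supportFn_minkowski]
  linarith [supportFn_mono h u, supportFn_mono h (H.reflection u)]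

theorem minkowski_subset_closedBall (H : Submodule ℝ (Euc n)) {K : ConvexCompact n} {R : ℝ}
    (hR : 0 ≤ R) (hK : (K : Set (Euc n)) ⊆ Metric.closedBall 0 R) :
    ((minkowskiSymmetrization n).sym H K : Set (Euc n)) ⊆ Metric.closedBall 0 R := by
  rw [subset_closedBall_iff hR] at hK ⊢
  intro u
  have h1 := hK u
  have h2 := hK (H.reflection u)
  rw [inner_zero_right, LinearIsometryEquiv.norm_map] at h2
  rw [inner_zero_right] at h1 ⊢
  rw [supportFn_minkowski]
  linarith

theorem exists_closedBall_subset_minkowski (H : Submodule ℝ (Euc n)) {K : ConvexCompact n}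
    {c : Euc n} {r : ℝ} (hr : 0 ≤ r) (hK : Metric.closedBall c r ⊆ (K : Set (Euc n))) :
    ∃ c', Metric.closedBall c' r ⊆ ((minkowskiSymmetrization n).sym H K : Set (Euc n)) := by
  refine ⟨(1 / 2 : ℝ) • (c + H.reflection c), ?_⟩
  rw [closedBall_subset_iff hr] at hK ⊢
  intro u
  have h1 := hK u
  have h2 := hK (H.reflection u)
  rw [← inner_reflection_comm, LinearIsometryEquiv.norm_map] at h2
  rw [supportFn_minkowski, inner_smul_right, inner_add_right]
  linarith

end Minkowski

/-! ### Bounds valid for every symmetrization in the family. -/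

section Family

open MeasureTheory
open scoped RealInnerProductSpace Pointwise

variable {n : ℕ}

theorem sub_reflection_mem_orthogonal (H : Submodule ℝ (Euc n)) (u : Euc n) :
    u - H.reflection u ∈ Hᗮ := by
  have : u - H.reflection u = (2 : ℝ) • (u - H.starProjection u) := by
    rw [H.reflection_apply, two_smul, two_smul]; abel
  rw [this]
  exact Submodule.smul_mem _ _ (H.sub_starProjection_mem_orthogonal u)

theorem reflection_of_mem_orthogonal {H : Submodule ℝ (Euc n)} {x : Euc n} (hx : x ∈ Hᗮ) :
    H.reflection x = -x :=
  H.reflection_mem_subspace_orthogonalComplement_eq_neg hx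

namespace Symmetrization

variable {D : Symmetrization n}

/-- A translation of K along H^⊥ equalizes its support values at u and R_H u. The translate then
lies in an H-symmetric set L bounded by the two half-spaces at the common level, and monotonicity
with translation invariance puts D_H K inside L. -/
theorem supportFn_sym_le (hD : D ∈ familyF n) (H : Submodule ℝ (Euc n)) (K : ConvexCompact n)
    (u : Euc n) :
    supportFn (D.sym H K) u ≤ (supportFn K u + supportFn K (H.reflection u)) / 2 := by
  obtain ⟨R, hR, hK⟩ := exists_subset_closedBall K
  set v : Euc n := (1 / 2 : ℝ) • (u - H.reflection u) with hv
  have hvH : v ∈ Hᗮ := Submodule.smul_mem _ _ (sub_reflection_mem_orthogonal H u)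
  have hRv : H.reflection v = -v := reflection_of_mem_orthogonal hvH
  have hRu : H.reflection u = u - (2 : ℝ) • v := by rw [hv, smul_smul]; norm_num
  -- Since ⟪u, v⟫ = ‖v‖² and ⟪R_H u, v⟫ = -‖v‖², moving K by -t • v brings both support values to
  -- their average. If v = 0 then R_H u = u and the value t = 0 is right.
  set t : ℝ := (supportFn K u - supportFn K (H.reflection u)) / (2 * ‖v‖ ^ 2) with ht
  have htv : t * ‖v‖ ^ 2 = (supportFn K u - supportFn K (H.reflection u)) / 2 := by
    rcases eq_or_ne v 0 with h0 | h0
    · simp [h0, hRu]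
    · have : ‖v‖ ≠ 0 := norm_ne_zero_iff.2 h0
      rw [ht]; field_simp
  have huv : ⟪u, v⟫ = ‖v‖ ^ 2 := by
    have := H.reflection.inner_map_map u v
    rw [hRv, hRu, inner_neg_right, inner_sub_left, inner_smul_left,
      real_inner_self_eq_norm_sq] at this
    simp only [conj_trivial] at this
    linarith
  have hRuv : ⟪H.reflection u, v⟫ = -‖v‖ ^ 2 := by
    rw [← inner_reflection_comm, hRv, inner_neg_right, huv]
  set α : ℝ := (supportFn K u + supportFn K (H.reflection u)) / 2 with hα
  set x : Euc n := t • v with hx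
  set ρ : ℝ := R + ‖x‖
  -- The ball only serves to make the set compact; its radius is large enough to contain K - x.
  let s : Set (Euc n) := Metric.closedBall 0 ρ ∩ ({y | ⟪u, y⟫ ≤ α} ∩ {y | ⟪H.reflection u, y⟫ ≤ α})
  have hmem : ∀ z ∈ K, z - x ∈ s := by
    intro z hz
    have h1 := inner_le_supportFn hz u
    have h2 := inner_le_supportFn hz (H.reflection u)
    refine ⟨mem_closedBall_zero_iff.2 ?_, ?_, ?_⟩
    · exact (norm_sub_le _ _).trans (add_le_add_left (mem_closedBall_zero_iff.1 (hK hz)) _)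
    · change ⟪u, z - x⟫ ≤ α
      rw [inner_sub_right, hx, inner_smul_right, huv]
      linarith
    · change ⟪H.reflection u, z - x⟫ ≤ α
      rw [inner_sub_right, hx, inner_smul_right, hRuv]
      linarith
  have hhalf : ∀ w : Euc n, Convex ℝ {y : Euc n | ⟪w, y⟫ ≤ α} ∧ IsClosed {y : Euc n | ⟪w, y⟫ ≤ α} :=
    fun w => ⟨convex_halfSpace_le (innerSL ℝ w).toLinearMap.isLinear α,
      isClosed_le (by fun_prop) continuous_const⟩
  let L : ConvexCompact n :=
    { carrier := s
      convex' := (convex_closedBall 0 ρ).inter ((hhalf _).1.inter (hhalf _).1)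
      isCompact' := (isCompact_closedBall 0 ρ).inter_right ((hhalf _).2.inter (hhalf _).2)
      nonempty' := K.nonempty.elim fun z hz => ⟨z - x, hmem z hz⟩ }
  have hLs : ∀ y ∈ s, H.reflection y ∈ s := by
    rintro y ⟨h1, h2, h3⟩
    refine ⟨?_, ?_, ?_⟩
    · rw [mem_closedBall_zero_iff] at h1 ⊢
      rwa [LinearIsometryEquiv.norm_map]
    · change ⟪u, H.reflection y⟫ ≤ α
      rwa [inner_reflection_comm]
    · change ⟪H.reflection u, H.reflection y⟫ ≤ α
      rwa [LinearIsometryEquiv.inner_map_map]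
  have hLsymm : IsSymmWrt H L := by
    refine Set.Subset.antisymm (Set.image_subset_iff.2 hLs) fun y hy => ?_
    exact ⟨H.reflection y, hLs y hy, H.reflection_reflection y⟩
  have hKL : (K : Set (Euc n)) ⊆ translateBody L x := fun z hz =>
    ⟨z - x, hmem z hz, sub_add_cancel z x⟩
  have hsub := hD.1 H _ _ hKL
  rw [hD.2.1 H L hLsymm x (Submodule.smul_mem _ _ hvH)] at hsub
  exact supportFn_le fun y hy => (hsub hy).2.1

theorem sym_subset_minkowski (hD : D ∈ familyF n) (H : Submodule ℝ (Euc n))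
    (K : ConvexCompact n) :
    (D.sym H K : Set (Euc n)) ⊆ (minkowskiSymmetrization n).sym H K :=
  subset_of_supportFn_le fun u => by
    rw [supportFn_minkowski]
    exact supportFn_sym_le hD H K u

/-- The segment from a to b is a translate, along H^⊥, of the H-symmetric segment from (a + R_H b)/2
to its reflection; D_H undoes the translation, and monotonicity puts the symmetric segment in D_H K.
-/
theorem half_add_reflection_mem_sym (hD : D ∈ familyF n) (H : Submodule ℝ (Euc n))
    {K : ConvexCompact n} {a b : Euc n} (ha : a ∈ K) (hb : b ∈ K) (hab : a - b ∈ Hᗮ) :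
    (1 / 2 : ℝ) • (a + H.reflection b) ∈ D.sym H K := by
  set p : Euc n := (1 / 2 : ℝ) • (a + H.reflection b) with hp
  set q : Euc n := (1 / 2 : ℝ) • (b + H.reflection a) with hq
  have hpq : H.reflection p = q := by
    rw [hp, hq, map_smul, map_add, H.reflection_reflection, add_comm]
  have hqp : H.reflection q = p := by rw [← hpq, H.reflection_reflection]
  set x : Euc n := (1 / 2 : ℝ) • (a - H.reflection b) with hx
  have hxH : x ∈ Hᗮ := by
    refine Submodule.smul_mem _ _ ?_
    rw [← sub_add_sub_cancel a b]
    exact Submodule.add_mem _ hab (sub_reflection_mem_orthogonal H b)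
  have hpx : p + x = a := by
    rw [hp, hx]; module
  have hqx : q + x = b := by
    have h := reflection_of_mem_orthogonal hab
    rw [map_sub, sub_eq_iff_eq_add] at h
    rw [hq, hx, h]; module
  let L : ConvexCompact n :=
    { carrier := segment ℝ p q
      convex' := convex_segment p q
      isCompact' := by
        rw [← convexHull_pair]
        exact (Set.toFinite {p, q}).isCompact_convexHull ℝ
      nonempty' := ⟨p, left_mem_segment ℝ p q⟩ }
  have hL : IsSymmWrt H L := by
    change H.reflection.toLinearEquiv.toLinearMap '' segment ℝ p q = segment ℝ p q
    refine (image_segment ℝ H.reflection.toLinearEquiv.toLinearMap.toAffineMap p q).trans ?_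
    change segment ℝ (H.reflection p) (H.reflection q) = _
    rw [hpq, hqp, segment_symm]
  have hLK : (translateBody L x : Set (Euc n)) ⊆ K := by
    rintro _ ⟨y, hy, rfl⟩
    have h1 : x + y ∈ segment ℝ (x + p) (x + q) := (mem_segment_translate ℝ x).2 hy
    rw [add_comm x p, add_comm x q, hpx, hqx, add_comm] at h1
    exact K.convex.segment_subset ha hb h1
  have hsub := hD.1 H _ _ hLK
  rw [hD.2.1 H L hL x hxH] at hsub
  exact hsub (left_mem_segment ℝ p q)

end Symmetrization

/-- An orthonormal basis some of whose members span a given subspace, the others being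
orthogonal to it. -/
theorem exists_orthonormalBasis_adapted (H : Submodule ℝ (Euc n)) :
    ∃ (b : OrthonormalBasis (Fin n) ℝ (Euc n)) (J : Finset (Fin n)),
      (∀ i ∈ J, b i ∈ Hᗮ) ∧ ∀ i ∉ J, b i ∈ H := by
  let V : Bool → Submodule ℝ (Euc n) := fun s => cond s H Hᗮ
  have hV : DirectSum.IsInternal V :=
    (DirectSum.isInternal_submodule_iff_isCompl V (i := true) (j := false) (by simp)
      (by ext s; cases s <;> simp)).2 H.isCompl_orthogonal
  have hV' : OrthogonalFamily ℝ (fun s => V s) fun s => (V s).subtypeₗᵢ := by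
    refine OrthogonalFamily.of_pairwise fun s t hst => ?_
    cases s <;> cases t
    · exact absurd rfl hst
    · exact H.isOrtho_orthogonal_left
    · exact H.isOrtho_orthogonal_right
    · exact absurd rfl hst
  have hn : Module.finrank ℝ (Euc n) = n := finrank_euclideanSpace_fin
  refine ⟨hV.subordinateOrthonormalBasis hn hV',
    Finset.univ.filter fun i => hV.subordinateOrthonormalBasisIndex hn i hV' = false, fun i hi => ?_, fun i hi => ?_⟩
  · have := hV.subordinateOrthonormalBasis_subordinate hn i hV'
    rwa [(Finset.mem_filter.1 hi).2] at this
  · have := hV.subordinateOrthonormalBasis_subordinate hn i hV'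
    have h2 : hV.subordinateOrthonormalBasisIndex hn i hV' = true := by
      simpa using hi
    rwa [h2] at this

/-- In orthonormal coordinates adapted to H and H^⊥, the points (a + R_H b)/2 of
`half_add_reflection_mem_sym` are those required by `volume_le_of_coord_half_sub_mem`. -/
theorem volume_le_volume_sym {D : Symmetrization n} (hD : D ∈ Symmetrization.familyF n)
    (H : Submodule ℝ (Euc n)) (K : ConvexCompact n) :
    volume (K : Set (Euc n)) ≤ volume (D.sym H K : Set (Euc n)) := by
  obtain ⟨b, J, hJ, hJ'⟩ := exists_orthonormalBasis_adapted H
  let e : Euc n ≃ᵐ (Fin n → ℝ) := b.measurableEquiv.trans (MeasurableEquiv.toLp 2 (Fin n → ℝ)).symm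
  have he : MeasurePreserving e := by
    exact (PiLp.volume_preserving_ofLp (Fin n)).comp b.measurePreserving_measurableEquiv
  have hes : ∀ y i, e y i = ⟪b i, y⟫ := fun y i => b.repr_apply_apply y i
  rw [← he.symm.measure_preimage_equiv, ← he.symm.measure_preimage_equiv]
  refine volume_le_of_coord_half_sub_mem J (e.symm.measurable K.isClosed.measurableSet)
    (e.symm.measurable (D.sym H K).isClosed.measurableSet) ?_
  intro x hx y hy hxy
  obtain ⟨x, rfl⟩ := e.surjective x
  obtain ⟨y, rfl⟩ := e.surjective y
  simp only [Set.mem_preimage, MeasurableEquiv.symm_apply_apply] at hx hy ⊢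
  have hmem : x - y ∈ Hᗮ := by
    rw [← b.sum_repr' (x - y)]
    refine Submodule.sum_mem _ fun i _ => ?_
    by_cases hi : i ∈ J
    · exact Submodule.smul_mem _ _ (hJ i hi)
    · have := hxy i hi
      rw [hes, hes] at this
      rw [inner_sub_right, this, sub_self, zero_smul]
      exact Submodule.zero_mem _
  suffices h : (e.symm fun i => if i ∈ J then (e x i - e y i) / 2 else e x i) =
      (1 / 2 : ℝ) • (x + H.reflection y) by
    rw [h]; exact Symmetrization.half_add_reflection_mem_sym hD H hx hy hmem
  rw [MeasurableEquiv.symm_apply_eq]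
  funext i
  simp only [hes]
  rw [inner_smul_right, inner_add_right, inner_reflection_comm]
  by_cases hi : i ∈ J
  · rw [if_pos hi, reflection_of_mem_orthogonal (hJ i hi), inner_neg_left]
    ring
  · have := hxy i hi
    rw [hes, hes] at this
    rw [if_neg hi, H.reflection_mem_subspace_eq_self (hJ' i hi), ← this]
    ring

end Family

/-! ### Limits of nested balls, and convergence from inside by volume. -/

section BallLimits

open MeasureTheory
open scoped RealInnerProductSpace Pointwise

variable {n : ℕ}

theorem volume_closedBall_eq (c : Euc n) {r : ℝ} (hr : 0 ≤ r) :
    volume (Metric.closedBall c r) =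
      ENNReal.ofReal (r ^ n) * volume (Metric.ball (0 : Euc n) 1) := by
  rw [Measure.addHaar_closedBall volume c hr, finrank_euclideanSpace_fin]

theorem volume_unit_ball_ne_zero : volume (Metric.ball (0 : Euc n) 1) ≠ 0 :=
  (Metric.measure_ball_pos volume 0 one_pos).ne'

theorem volume_unit_ball_ne_top : volume (Metric.ball (0 : Euc n) 1) ≠ ⊤ :=
  measure_ball_lt_top.ne

theorem le_volume_closedBall_of_tendsto {P : ℕ → ConvexCompact n} {c : Euc n} {r : ℝ}
    (hr : 0 ≤ r) (hP : Tendsto P atTop (𝓝 (ballBody c r hr))) {V : ENNReal}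
    (hV : ∀ i, V ≤ volume (P i : Set (Euc n))) : V ≤ volume (Metric.closedBall (0 : Euc n) r) := by
  have h1 : ∀ ε ∈ Set.Ioi (0 : ℝ),
      V ≤ ENNReal.ofReal ((r + ε) ^ n) * volume (Metric.ball (0 : Euc n) 1) := by
    intro ε hε
    have hε' : (0 : ℝ) < ε := hε
    obtain ⟨m, hm⟩ := ((tendsto_ballBody_iff hr).1 hP ε hε').exists
    have hs := (subset_closedBall_iff (c := c) (by positivity : 0 ≤ r + ε)).2 fun u => (hm u).2
    exact (hV m).trans ((measure_mono hs).trans_eq (volume_closedBall_eq c (by positivity)))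
  rw [volume_closedBall_eq 0 hr]
  have h2 : Tendsto (fun ε : ℝ => ENNReal.ofReal ((r + ε) ^ n) *
      volume (Metric.ball (0 : Euc n) 1)) (𝓝[>] 0)
      (𝓝 (ENNReal.ofReal (r ^ n) * volume (Metric.ball (0 : Euc n) 1))) := by
    refine ENNReal.Tendsto.mul_const (ENNReal.tendsto_ofReal ?_) (Or.inr volume_unit_ball_ne_top)
    have : Continuous fun ε : ℝ => (r + ε) ^ n := by fun_prop
    simpa using this.continuousWithinAt (s := Set.Ioi 0) (x := (0 : ℝ)) |>.tendsto
  exact ge_of_tendsto h2 (eventually_mem_nhdsWithin.mono h1)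

theorem exists_norm_eq_one [NeZero n] : ∃ u : Euc n, ‖u‖ = 1 :=
  ⟨EuclideanSpace.single 0 1, by simp⟩

/-- Centres move by at most the growth of the radii, so they form a Cauchy sequence. The radii may
be negative, which lets the same lemma treat decreasing balls. -/
theorem exists_tendsto_of_nested [NeZero n] {c : ℕ → Euc n} {r : ℕ → ℝ} {B : ℝ}
    (hB : ∀ j, r j ≤ B)
    (h : ∀ j u, ⟪u, c j⟫ + r j * ‖u‖ ≤ ⟪u, c (j + 1)⟫ + r (j + 1) * ‖u‖) :
    ∃ c' r', Tendsto c atTop (𝓝 c') ∧ Tendsto r atTop (𝓝 r') ∧ ∀ j, r j ≤ r' := by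
  obtain ⟨e, he⟩ := exists_norm_eq_one (n := n)
  have hmono : Monotone r := monotone_nat_of_le_succ fun j => by
    have h1 := h j e
    have h2 := h j (-e)
    rw [norm_neg, inner_neg_left, inner_neg_left] at h2
    rw [he] at h1 h2
    linarith
  have hstep : ∀ j, dist (c j) (c (j + 1)) ≤ r (j + 1) - r j := by
    intro j
    rw [dist_eq_norm]
    rcases eq_or_ne (c j - c (j + 1)) 0 with h0 | h0
    · rw [h0, norm_zero, sub_nonneg]; exact hmono j.le_succ
    · have h1 := h j (c j - c (j + 1))
      have h2 := real_inner_self_eq_norm_sq (c j - c (j + 1))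
      rw [inner_sub_right (c j - c (j + 1)) (c j) (c (j + 1))] at h2
      have hpos := norm_pos_iff.2 h0
      refine le_of_mul_le_mul_right ?_ hpos
      nlinarith
  have hdist : ∀ i j, i ≤ j → dist (c i) (c j) ≤ r j - r i := by
    intro i j hij
    induction j, hij using Nat.le_induction with
    | base => simp
    | succ j _ ih => linarith [dist_triangle (c i) (c j) (c (j + 1)), hstep j]
  have hbdd : BddAbove (Set.range r) := ⟨B, by rintro _ ⟨j, rfl⟩; exact hB j⟩
  have hr := tendsto_atTop_ciSup hmono hbdd
  have hle : ∀ j, r j ≤ ⨆ i, r i := le_ciSup hbdd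
  have hc : CauchySeq c := by
    refine cauchySeq_of_le_tendsto_0 (fun N => 2 * ((⨆ i, r i) - r N)) (fun i j N hi hj => ?_) ?_
    · have := dist_triangle_left (c i) (c j) (c N)
      linarith [hdist N i hi, hdist N j hj, hle i, hle j]
    · simpa using (hr.const_sub (⨆ i, r i)).const_mul 2
  obtain ⟨c', hc'⟩ := cauchySeq_tendsto_of_complete hc
  exact ⟨c', _, hc', hr, hle⟩

theorem abs_inner_add_mul_norm_sub_le (c c' u : Euc n) (r r' : ℝ) :
    |(⟪u, c⟫ + r * ‖u‖) - (⟪u, c'⟫ + r' * ‖u‖)| ≤ (dist c c' + dist r r') * ‖u‖ := by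
  have h1 : (⟪u, c⟫ + r * ‖u‖) - (⟪u, c'⟫ + r' * ‖u‖) = ⟪u, c - c'⟫ + (r - r') * ‖u‖ := by
    rw [inner_sub_right]; ring
  rw [h1, dist_eq_norm, Real.dist_eq, add_mul]
  refine (abs_add_le _ _).trans (add_le_add ?_ ?_)
  · rw [mul_comm]; exact abs_real_inner_le_norm _ _
  · rw [abs_mul, abs_norm]

/-- A convex set with a point far from a ball that it nearly contains has larger volume
than the ball. -/
theorem exists_forall_volume_lt [NeZero n] (c : Euc n) {r ε : ℝ} (hr : 0 < r) (hε : 0 < ε)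
    (R : ℝ) : ∃ δ > 0, ∀ K : ConvexCompact n, (K : Set (Euc n)) ⊆ Metric.closedBall 0 R →
      (∀ u, ⟪u, c⟫ + (r - δ) * ‖u‖ ≤ supportFn K u) →
      ∀ p ∈ K, r + ε < ‖p - c‖ → volume (Metric.closedBall (0 : Euc n) r) <
        volume (K : Set (Euc n)) := by
  set Λ : ℝ := |R| + ‖c‖ + 1 with hΛ
  have hΛ0 : 0 < Λ := by positivity
  -- K contains the image of B(c, r - δ) under the homothety with centre p and ratio 1 - t, a ball
  -- about a point q at distance r + ε/2 from c. As ‖p - c‖ ≤ Λ and δ < r/2, its radius is at least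
  -- η; the bound ε/4 makes the ball B(q, η) disjoint from B(c, r - δ). Since η does not depend on
  -- δ, small δ gives (r - δ)^n + η^n > r^n.
  set η : ℝ := min (ε / 4) (ε / 2 / Λ * (r / 2)) with hη
  have hη0 : 0 < η := lt_min (by positivity) (by positivity)
  have hcont : Continuous fun δ : ℝ => (r - δ) ^ n + η ^ n := by fun_prop
  have hlim : Tendsto (fun δ : ℝ => (r - δ) ^ n + η ^ n) (𝓝[>] 0) (𝓝 (r ^ n + η ^ n)) := by
    simpa using hcont.continuousWithinAt (s := Set.Ioi 0) (x := (0 : ℝ)) |>.tendsto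
  have h1 := hlim.eventually_const_lt (lt_add_of_pos_right (r ^ n) (pow_pos hη0 n))
  obtain ⟨δ, ⟨hδ1, hδ0⟩, hδ2⟩ := ((h1.and eventually_mem_nhdsWithin).and
    (mem_nhdsWithin_of_mem_nhds (Iio_mem_nhds (half_pos hr)))).exists
  have hδ0 : 0 < δ := hδ0
  have hδ2 : δ < r / 2 := hδ2
  refine ⟨δ, hδ0, fun K hKR hK p hp hpc => ?_⟩
  have hd0 : 0 < ‖p - c‖ := by linarith
  have hdΛ : ‖p - c‖ ≤ Λ := by
    have := mem_closedBall_zero_iff.1 (hKR hp)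
    linarith [norm_sub_le p c, le_abs_self R]
  set t : ℝ := (r + ε / 2) / ‖p - c‖ with ht
  have ht0 : 0 ≤ t := by positivity
  have htd : t * ‖p - c‖ = r + ε / 2 := by rw [ht]; field_simp
  have ht1 : ε / 2 / Λ ≤ 1 - t := by
    have : 1 - t = (‖p - c‖ - r - ε / 2) / ‖p - c‖ := by rw [ht]; field_simp; ring
    rw [this]
    exact div_le_div₀ (by linarith) (by linarith) hd0 hdΛ
  have ht2 : 0 ≤ 1 - t := le_trans (by positivity) ht1
  have hηt : η ≤ (1 - t) * (r - δ) :=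
    (min_le_right _ _).trans (mul_le_mul ht1 (by linarith) (by positivity) ht2)
  set q : Euc n := c + t • (p - c) with hq
  have hball1 : Metric.closedBall c (r - δ) ⊆ (K : Set (Euc n)) :=
    (closedBall_subset_iff (by linarith)).2 hK
  have hball2 : Metric.closedBall q η ⊆ (K : Set (Euc n)) := by
    refine (closedBall_subset_iff hη0.le).2 fun u => ?_
    have e1 : ⟪u, q⟫ = (1 - t) * ⟪u, c⟫ + t * ⟪u, p⟫ := by
      rw [hq, inner_add_right, inner_smul_right, inner_sub_right]; ring
    have e2 := mul_le_mul_of_nonneg_left (hK u) ht2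
    have e3 := mul_le_mul_of_nonneg_left (inner_le_supportFn hp u) ht0
    have e4 := mul_le_mul_of_nonneg_right hηt (norm_nonneg u)
    rw [e1]
    nlinarith
  have hdisj : Disjoint (Metric.closedBall c (r - δ)) (Metric.closedBall q η) := by
    refine Metric.closedBall_disjoint_closedBall ?_
    have : dist c q = r + ε / 2 := by
      rw [dist_comm, dist_eq_norm, hq, add_sub_cancel_left, norm_smul, Real.norm_of_nonneg ht0, htd]
    rw [this]
    have := min_le_left (ε / 4) (ε / 2 / Λ * (r / 2))
    linarith
  calc volume (Metric.closedBall (0 : Euc n) r)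
      = ENNReal.ofReal (r ^ n) * volume (Metric.ball (0 : Euc n) 1) := volume_closedBall_eq 0 hr.le
    _ < ENNReal.ofReal ((r - δ) ^ n + η ^ n) * volume (Metric.ball (0 : Euc n) 1) := by
        refine ENNReal.mul_lt_mul_left volume_unit_ball_ne_zero volume_unit_ball_ne_top ?_
        exact (ENNReal.ofReal_lt_ofReal_iff_of_nonneg (by positivity)).2 hδ1
    _ = volume (Metric.closedBall c (r - δ) ∪ Metric.closedBall q η) := by
        rw [measure_union hdisj measurableSet_closedBall, volume_closedBall_eq c (by linarith),
          volume_closedBall_eq q hη0.le, ← add_mul, ENNReal.ofReal_add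
            (pow_nonneg (by linarith) n) (by positivity)]
    _ ≤ volume (K : Set (Euc n)) := measure_mono (Set.union_subset hball1 hball2)

/-- A bounded sequence of convex bodies that eventually nearly contain each of the nested balls
`B(c j, r j)`, with volumes bounded by those of the balls, converges to a ball. -/
theorem tendsto_ballBody_of_inner_balls [NeZero n] {P : ℕ → ConvexCompact n} {R : ℝ}
    (hP : ∀ m, (P m : Set (Euc n)) ⊆ Metric.closedBall 0 R) {c : ℕ → Euc n} {r : ℕ → ℝ}
    (hin : ∀ j, ∀ δ > 0, ∀ᶠ m in atTop, ∀ u, ⟪u, c j⟫ + (r j - δ) * ‖u‖ ≤ supportFn (P m) u)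
    (hnest : ∀ j u, ⟪u, c j⟫ + r j * ‖u‖ ≤ ⟪u, c (j + 1)⟫ + r (j + 1) * ‖u‖)
    (hr0 : ∀ j, 0 < r j)
    (hvol : ∀ j, volume (P j : Set (Euc n)) ≤ volume (Metric.closedBall (0 : Euc n) (r j))) :
    ∃ (c' : Euc n) (r' : ℝ) (hr' : 0 ≤ r'), Tendsto P atTop (𝓝 (ballBody c' r' hr')) := by
  obtain ⟨e, he⟩ := exists_norm_eq_one (n := n)
  have hR : 0 ≤ R := by
    obtain ⟨x, hx⟩ := (P 0).nonempty
    exact (norm_nonneg x).trans (mem_closedBall_zero_iff.1 (hP 0 hx))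
  have hB : ∀ j, r j ≤ R + 1 := by
    intro j
    obtain ⟨m, hm⟩ := (hin j 1 one_pos).exists
    have h1 := hm e
    have h2 := hm (-e)
    have h3 := (subset_closedBall_iff hR).1 (hP m) e
    have h4 := (subset_closedBall_iff hR).1 (hP m) (-e)
    simp only [norm_neg, he, inner_neg_left, inner_zero_right] at h1 h2 h3 h4
    linarith
  obtain ⟨c', r', hc, hr, hle⟩ := exists_tendsto_of_nested hB hnest
  have hr' : 0 < r' := (hr0 0).trans_le (hle 0)
  have hlow : ∀ δ > 0, ∀ᶠ m in atTop, ∀ u, ⟪u, c'⟫ + (r' - δ) * ‖u‖ ≤ supportFn (P m) u := by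
    intro δ hδ
    obtain ⟨j, hj1, hj2⟩ := ((Metric.tendsto_nhds.1 hc (δ / 4) (by positivity)).and
      (Metric.tendsto_nhds.1 hr (δ / 4) (by positivity))).exists
    filter_upwards [hin j (δ / 4) (by positivity)] with m hm u
    have h1 := (abs_le.1 (abs_inner_add_mul_norm_sub_le (c j) c' u (r j) r')).1
    have h2 : (dist (c j) c' + dist (r j) r') * ‖u‖ ≤ δ / 2 * ‖u‖ :=
      mul_le_mul_of_nonneg_right (by linarith) (norm_nonneg u)
    nlinarith [hm u, norm_nonneg u]
  refine ⟨c', r', hr'.le, (tendsto_ballBody_iff hr'.le).2 fun ε hε => ?_⟩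
  obtain ⟨δ, hδ, hδK⟩ := exists_forall_volume_lt c' hr' hε R
  filter_upwards [hlow ε hε, hlow δ hδ] with m hm1 hm2
  have hsub : (P m : Set (Euc n)) ⊆ Metric.closedBall c' (r' + ε) := by
    intro p hp
    by_contra hpc
    rw [mem_closedBall_iff_norm, not_le] at hpc
    refine (hδK (P m) (hP m) hm2 p hp hpc).not_ge ((hvol m).trans ?_)
    exact measure_mono (Metric.closedBall_subset_closedBall (hle m))
  exact fun u => ⟨hm1 u, (subset_closedBall_iff (by positivity)).1 hsub u⟩

end BallLimits

/-! ### Mean width, and convergence from outside. -/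

section MeanWidth

open MeasureTheory
open scoped RealInnerProductSpace Pointwise

variable {n : ℕ}

theorem supportFn_smul_right (K : ConvexCompact n) {a : ℝ} (ha : 0 ≤ a) (u : Euc n) :
    supportFn K (a • u) = a * supportFn K u := by
  apply le_antisymm
  · refine supportFn_le fun x hx => ?_
    rw [real_inner_smul_left]
    exact mul_le_mul_of_nonneg_left (inner_le_supportFn hx u) ha
  · obtain ⟨x, hx, ex⟩ := exists_inner_eq_supportFn K u
    rw [← ex, ← real_inner_smul_left]
    exact inner_le_supportFn hx _

theorem integrableOn_ball_of_continuous {f : Euc n → ℝ} (hf : Continuous f) (c : Euc n) (s : ℝ) :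
    IntegrableOn f (Metric.ball c s) :=
  (hf.continuousOn.integrableOn_compact (isCompact_closedBall c s)).mono_set
    Metric.ball_subset_closedBall

theorem setIntegral_ball_comp_isometry (T : Euc n ≃ₗᵢ[ℝ] Euc n) (f : Euc n → ℝ) (s : ℝ) :
    ∫ u in Metric.ball 0 s, f (T u) = ∫ u in Metric.ball 0 s, f u := by
  have h := T.measurePreserving.setIntegral_preimage_emb
    T.toHomeomorph.measurableEmbedding f (Metric.ball 0 s)
  rwa [T.preimage_ball, map_zero] at h

theorem setIntegral_ball_inner (c : Euc n) (s : ℝ) :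
    ∫ u in Metric.ball (0 : Euc n) s, ⟪u, c⟫ = 0 := by
  have h := setIntegral_ball_comp_isometry (LinearIsometryEquiv.neg ℝ) (fun u : Euc n => ⟪u, c⟫) s
  simp only [LinearIsometryEquiv.coe_neg, inner_neg_left, integral_neg] at h
  linarith

/-- A multiple of the mean width of a convex body. -/
noncomputable def meanWidth (K : ConvexCompact n) : ℝ :=
  ∫ u in Metric.ball (0 : Euc n) 2, supportFn K u

theorem setIntegral_ball_inner_add (c : Euc n) (r : ℝ) :
    ∫ u in Metric.ball (0 : Euc n) 2, (⟪u, c⟫ + r * ‖u‖) =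
      r * ∫ u in Metric.ball (0 : Euc n) 2, ‖u‖ := by
  rw [integral_add (integrableOn_ball_of_continuous (by fun_prop) _ _)
    (integrableOn_ball_of_continuous (by fun_prop) _ _), setIntegral_ball_inner, zero_add,
    integral_const_mul]

/-- The integral over a centred ball is invariant under u ↦ R_H u, so both halves of the averaged
support function contribute equally. -/
theorem meanWidth_minkowski (H : Submodule ℝ (Euc n)) (K : ConvexCompact n) :
    meanWidth ((minkowskiSymmetrization n).sym H K) = meanWidth K := by
  have hK := continuous_supportFn K
  unfold meanWidth
  simp_rw [supportFn_minkowski, add_div]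
  rw [integral_add (integrableOn_ball_of_continuous (by fun_prop) _ _)
    (integrableOn_ball_of_continuous (by fun_prop) _ _), integral_div, integral_div,
    setIntegral_ball_comp_isometry H.reflection (supportFn K)]
  ring

theorem meanWidth_eq_of_tendsto {P : ℕ → ConvexCompact n} {c : Euc n} {r : ℝ} (hr : 0 ≤ r)
    (hP : Tendsto P atTop (𝓝 (ballBody c r hr))) {W : ℝ} (hW : ∀ i, meanWidth (P i) = W) :
    W = r * ∫ u in Metric.ball (0 : Euc n) 2, ‖u‖ := by
  set A := ∫ u in Metric.ball (0 : Euc n) 2, ‖u‖ with hA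
  have hA0 : 0 ≤ A := integral_nonneg fun u => norm_nonneg u
  have hbound : ∀ ε > 0, |W - r * A| ≤ ε * A := by
    intro ε hε
    obtain ⟨m, hm⟩ := ((tendsto_ballBody_iff hr).1 hP ε hε).exists
    have hc := integrableOn_ball_of_continuous (continuous_supportFn (P m)) 0 2
    have h1 := setIntegral_mono (integrableOn_ball_of_continuous (by fun_prop) 0 2) hc
      fun u => (hm u).1
    have h2 := setIntegral_mono hc (integrableOn_ball_of_continuous (by fun_prop) 0 2)
      fun u => (hm u).2
    rw [setIntegral_ball_inner_add] at h1 h2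
    have h3 : ∫ u in Metric.ball (0 : Euc n) 2, supportFn (P m) u = W := hW m
    rw [h3] at h1 h2
    rw [abs_le]
    constructor <;> linarith
  have hlim : Tendsto (fun ε : ℝ => ε * A) (𝓝[>] 0) (𝓝 0) := by
    have : Continuous fun ε : ℝ => ε * A := by fun_prop
    simpa using this.continuousWithinAt (s := Set.Ioi 0) (x := (0 : ℝ)) |>.tendsto
  have := ge_of_tendsto hlim (eventually_mem_nhdsWithin.mono hbound)
  linarith [abs_nonpos_iff.1 this]

/-- A convex body nearly contained in a ball, and with nearly the same mean width, nearly contains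
the ball. -/
theorem exists_forall_meanWidth_lt (c : Euc n) {r ε : ℝ} (hr : 0 ≤ r) (hε : 0 < ε) {R : ℝ}
    (hR : 0 ≤ R) : ∃ δ > 0, ∀ K : ConvexCompact n, (K : Set (Euc n)) ⊆ Metric.closedBall 0 R →
      (∀ u, supportFn K u ≤ ⟪u, c⟫ + (r + δ) * ‖u‖) →
      ∀ v, supportFn K v < ⟪v, c⟫ + (r - ε) * ‖v‖ →
        meanWidth K < r * ∫ u in Metric.ball (0 : Euc n) 2, ‖u‖ := by
  set A := ∫ u in Metric.ball (0 : Euc n) 2, ‖u‖ with hA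
  have hA0 : 0 ≤ A := integral_nonneg fun u => norm_nonneg u
  -- For δ < 1 this bounds the rate at which the gap g below can drop away from w. A gap above ε at
  -- w thus stays at least ε/2 on the ball of radius s, of volume V, and δ is chosen with δ * A <
  -- ε/2 * V.
  set Λ : ℝ := R + ‖c‖ + r + 1 with hΛ
  have hΛ0 : 0 < Λ := by positivity
  set s : ℝ := min 1 (ε / (2 * Λ)) with hs
  have hs0 : 0 < s := lt_min one_pos (by positivity)
  have hsΛ : Λ * s ≤ ε / 2 := by
    calc Λ * s ≤ Λ * (ε / (2 * Λ)) := mul_le_mul_of_nonneg_left (min_le_right _ _) hΛ0.le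
      _ = ε / 2 := by field_simp
  set V : ℝ := volume.real (Metric.ball (0 : Euc n) s) with hV
  have hV0 : 0 < V := ENNReal.toReal_pos (Metric.measure_ball_pos volume 0 hs0).ne'
    measure_ball_lt_top.ne
  have hlim : Tendsto (fun δ : ℝ => δ * A) (𝓝[>] 0) (𝓝 0) := by
    have : Continuous fun ε : ℝ => ε * A := by fun_prop
    simpa using this.continuousWithinAt (s := Set.Ioi 0) (x := (0 : ℝ)) |>.tendsto
  obtain ⟨δ, ⟨hδ1, hδ0⟩, hδ2⟩ := (((hlim.eventually_lt_const
    (by positivity : 0 < ε / 2 * V)).and eventually_mem_nhdsWithin).and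
    (mem_nhdsWithin_of_mem_nhds (Iio_mem_nhds one_pos))).exists
  have hδ0 : 0 < δ := hδ0
  have hδ2 : δ < 1 := hδ2
  refine ⟨δ, hδ0, fun K hKR hK v hv => ?_⟩
  have hv0 : 0 < ‖v‖ := norm_pos_iff.2 fun h0 => by
    subst h0
    have := supportFn_smul_right K le_rfl (0 : Euc n)
    rw [zero_smul, zero_mul] at this
    simp [this] at hv
  set w : Euc n := ‖v‖⁻¹ • v with hw
  have hw1 : ‖w‖ = 1 := by rw [hw, norm_smul, norm_inv, norm_norm, inv_mul_cancel₀ hv0.ne']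
  have hKw : supportFn K w < ⟪w, c⟫ + (r - ε) := by
    rw [hw, supportFn_smul_right K (by positivity), real_inner_smul_left]
    calc ‖v‖⁻¹ * supportFn K v < ‖v‖⁻¹ * (⟪v, c⟫ + (r - ε) * ‖v‖) :=
          mul_lt_mul_of_pos_left hv (by positivity)
      _ = _ := by field_simp
  set g : Euc n → ℝ := fun u => (⟪u, c⟫ + (r + δ) * ‖u‖) - supportFn K u with hg
  have hcont := continuous_supportFn K
  have hgc : Continuous g := by fun_prop
  have hg0 : ∀ u, 0 ≤ g u := fun u => sub_nonneg.2 (hK u)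
  have hgi : ∫ u in Metric.ball (0 : Euc n) 2, g u = (r + δ) * A - meanWidth K := by
    rw [hg, integral_sub (integrableOn_ball_of_continuous (by fun_prop) _ _)
      (integrableOn_ball_of_continuous hcont _ _), setIntegral_ball_inner_add]
    rfl
  -- This is why mean width integrates over radius 2: w is a unit vector and s ≤ 1.
  have hsub : Metric.ball w s ⊆ Metric.ball 0 2 := by
    refine Metric.ball_subset_ball' ?_
    rw [dist_zero_right, hw1]
    linarith [min_le_left 1 (ε / (2 * Λ))]
  have hgw : ∀ u ∈ Metric.ball w s, ε / 2 ≤ g u := by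
    intro u hu
    have hu' : ‖u - w‖ < s := mem_ball_iff_norm.1 hu
    have h1 := supportFn_sub_le hKR u w
    have h2 := real_inner_le_norm (w - u) c
    have h3 := norm_sub_norm_le w u
    rw [norm_sub_rev w u, inner_sub_left] at h2
    rw [norm_sub_rev w u, hw1] at h3
    have h4 : (r + δ) * (1 - ‖u‖) ≤ (r + 1) * ‖u - w‖ := by
      calc (r + δ) * (1 - ‖u‖) ≤ (r + δ) * ‖u - w‖ := by gcongr
        _ ≤ (r + 1) * ‖u - w‖ := by gcongr
    have h5 : Λ * ‖u - w‖ ≤ Λ * s := by gcongr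
    simp only [hg]
    nlinarith
  have h1 : ε / 2 * V ≤ ∫ u in Metric.ball w s, g u := by
    have := setIntegral_ge_of_const_le_real measurableSet_ball measure_ball_lt_top.ne hgw
      (integrableOn_ball_of_continuous hgc w s)
    rwa [Measure.real, Measure.addHaar_ball_center] at this
  have h2 : ∫ u in Metric.ball w s, g u ≤ ∫ u in Metric.ball (0 : Euc n) 2, g u :=
    setIntegral_mono_set (integrableOn_ball_of_continuous hgc 0 2)
      (Eventually.of_forall hg0) hsub.eventuallyLE
  linarith

/-- A bounded sequence of convex bodies that are eventually nearly contained in each of the nested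
balls `B(c j, r j)`, with the same mean widths as the balls, converges to a ball. -/
theorem tendsto_ballBody_of_outer_balls [NeZero n] {P : ℕ → ConvexCompact n} {R : ℝ}
    (hP : ∀ m, (P m : Set (Euc n)) ⊆ Metric.closedBall 0 R) {c : ℕ → Euc n} {r : ℕ → ℝ}
    (hout : ∀ j, ∀ δ > 0, ∀ᶠ m in atTop, ∀ u, supportFn (P m) u ≤ ⟪u, c j⟫ + (r j + δ) * ‖u‖)
    (hnest : ∀ j u, ⟪u, c (j + 1)⟫ + r (j + 1) * ‖u‖ ≤ ⟪u, c j⟫ + r j * ‖u‖)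
    (hr0 : ∀ j, 0 ≤ r j)
    (hwidth : ∀ j, meanWidth (P j) = r j * ∫ u in Metric.ball (0 : Euc n) 2, ‖u‖) :
    ∃ (c' : Euc n) (r' : ℝ) (hr' : 0 ≤ r'), Tendsto P atTop (𝓝 (ballBody c' r' hr')) := by
  have hR : 0 ≤ R := by
    obtain ⟨x, hx⟩ := (P 0).nonempty
    exact (norm_nonneg x).trans (mem_closedBall_zero_iff.1 (hP 0 hx))
  -- Negating the radii and replacing u by -u turns decreasing balls into the increasing situation,
  -- with upper bound 0.
  obtain ⟨c', r'', hc, hr'', hle''⟩ := exists_tendsto_of_nested (c := c) (r := fun j => -r j)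
    (B := 0) (fun j => neg_nonpos.2 (hr0 j)) fun j u => by
      have := hnest j (-u)
      rw [norm_neg, inner_neg_left, inner_neg_left] at this
      linarith
  obtain ⟨r', rfl⟩ : ∃ r', r'' = -r' := ⟨-r'', (neg_neg r'').symm⟩
  have hr : Tendsto r atTop (𝓝 r') := by simpa using hr''.neg
  have hle : ∀ j, r' ≤ r j := fun j => neg_le_neg_iff.1 (hle'' j)
  have hr' : 0 ≤ r' := ge_of_tendsto' hr hr0
  have hup : ∀ δ > 0, ∀ᶠ m in atTop, ∀ u, supportFn (P m) u ≤ ⟪u, c'⟫ + (r' + δ) * ‖u‖ := by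
    intro δ hδ
    obtain ⟨j, hj1, hj2⟩ := ((Metric.tendsto_nhds.1 hc (δ / 4) (by positivity)).and
      (Metric.tendsto_nhds.1 hr (δ / 4) (by positivity))).exists
    filter_upwards [hout j (δ / 4) (by positivity)] with m hm u
    have h1 := (abs_le.1 (abs_inner_add_mul_norm_sub_le (c j) c' u (r j) r')).2
    have h2 : (dist (c j) c' + dist (r j) r') * ‖u‖ ≤ δ / 2 * ‖u‖ :=
      mul_le_mul_of_nonneg_right (by linarith) (norm_nonneg u)
    nlinarith [hm u, norm_nonneg u]
  refine ⟨c', r', hr', (tendsto_ballBody_iff hr').2 fun ε hε => ?_⟩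
  obtain ⟨δ, hδ, hδK⟩ := exists_forall_meanWidth_lt c' hr' hε hR
  filter_upwards [hup ε hε, hup δ hδ] with m hm1 hm2 u
  refine ⟨?_, hm1 u⟩
  by_contra hlt
  refine (hδK (P m) (hP m) hm2 u (not_le.1 hlt)).not_ge ?_
  rw [hwidth m]
  exact mul_le_mul_of_nonneg_right (hle m) (integral_nonneg fun u => norm_nonneg u)

end MeanWidth

/-! ### Comparison of processes and transfer of convergence. -/

section Convergence

open MeasureTheory
open scoped RealInnerProductSpace Pointwise

variable {n : ℕ}

namespace Symmetrization

variable {D : Symmetrization n} {H : ℕ → Submodule ℝ (Euc n)}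

theorem process_add (D : Symmetrization n) (H : ℕ → Submodule ℝ (Euc n)) (k : ℕ)
    (K : ConvexCompact n) (j i : ℕ) :
    D.process H k K (j + 1 + i) = D.process H (k + j + 1) (D.process H k K j) i := by
  induction i with
  | zero => rfl
  | succ i ih =>
    have e : k + (j + 1 + i + 1) = k + j + 1 + (i + 1) := by omega
    change D.sym (H (k + (j + 1 + i + 1))) (D.process H k K (j + 1 + i)) = _
    rw [ih, e]
    rfl

theorem process_mono (hD : D.IsMonotone) (k : ℕ) {K L : ConvexCompact n}
    (h : (K : Set (Euc n)) ⊆ L) (j : ℕ) :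
    (D.process H k K j : Set (Euc n)) ⊆ D.process H k L j := by
  induction j with
  | zero => exact hD _ _ _ h
  | succ j ih => exact hD _ _ _ ih

theorem process_subset_process {S : Symmetrization n} (hS : S.IsMonotone)
    (h : ∀ H K, (D.sym H K : Set (Euc n)) ⊆ S.sym H K) (k : ℕ) (K : ConvexCompact n) (j : ℕ) :
    (D.process H k K j : Set (Euc n)) ⊆ S.process H k K j := by
  induction j with
  | zero => exact h _ _
  | succ j ih => exact (h _ _).trans (hS _ _ _ ih)

theorem process_induction {p : ConvexCompact n → Prop} (h : ∀ H K, p K → p (D.sym H K))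
    (k : ℕ) {K : ConvexCompact n} (hK : p K) (j : ℕ) : p (D.process H k K j) := by
  induction j with
  | zero => exact h _ _ hK
  | succ j ih => exact h _ _ ih

theorem volume_le_volume_process (hD : D ∈ familyF n) (k : ℕ) (K : ConvexCompact n) (j : ℕ) :
    volume (K : Set (Euc n)) ≤ volume (D.process H k K j : Set (Euc n)) :=
  process_induction (p := fun L => volume (K : Set (Euc n)) ≤ volume (L : Set (Euc n)))
    (fun H L h => h.trans (volume_le_volume_sym hD H L)) k le_rfl j

theorem meanWidth_process_minkowski (k : ℕ) (K : ConvexCompact n) (j : ℕ) :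
    meanWidth ((minkowskiSymmetrization n).process H k K j) = meanWidth K :=
  process_induction (p := fun L => meanWidth L = meanWidth K)
    (fun H L h => (meanWidth_minkowski H L).trans h) k rfl j

theorem sym_subset_closedBall (hD : D ∈ familyF n) (H : Submodule ℝ (Euc n))
    {K : ConvexCompact n} {R : ℝ} (hR : 0 ≤ R) (hK : (K : Set (Euc n)) ⊆ Metric.closedBall 0 R) :
    (D.sym H K : Set (Euc n)) ⊆ Metric.closedBall 0 R :=
  (sym_subset_minkowski hD H K).trans (minkowski_subset_closedBall H hR hK)

/-- The processes of `D` started at `K` converge to balls, for all starting indices and all `K`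
satisfying `p`. -/
def ConvergesToBalls (D : Symmetrization n) (H : ℕ → Submodule ℝ (Euc n))
    (p : ConvexCompact n → Prop) : Prop :=
  ∀ (k : ℕ) (K : ConvexCompact n), p K → ∃ (c : Euc n) (r : ℝ) (hr : 0 ≤ r),
    Tendsto (D.process H k K) atTop (𝓝 (ballBody c r hr))

theorem volume_pos_of_interior_nonempty {K : ConvexCompact n}
    (hK : (interior (K : Set (Euc n))).Nonempty) : 0 < volume (K : Set (Euc n)) :=
  Measure.measure_pos_of_nonempty_interior volume hK

/-- Volumes never decrease along the process, so the limit cannot be a point, which has volume zero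
when n > 0. -/
theorem radius_pos_of_tendsto_process [NeZero n] (hD : D ∈ familyF n) {k : ℕ}
    {K : ConvexCompact n} (hK : (interior (K : Set (Euc n))).Nonempty) {c : Euc n} {r : ℝ}
    {hr : 0 ≤ r} (h : Tendsto (D.process H k K) atTop (𝓝 (ballBody c r hr))) : 0 < r := by
  refine hr.lt_of_ne' fun h0 => ?_
  have h1 := le_volume_closedBall_of_tendsto hr h (volume_le_volume_process hD k K)
  rw [volume_closedBall_eq 0 hr, h0, zero_pow (NeZero.ne n), ENNReal.ofReal_zero, zero_mul] at h1
  exact (volume_pos_of_interior_nonempty hK).not_ge h1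

theorem interior_minkowski_nonempty (H : Submodule ℝ (Euc n)) (K : ConvexCompact n)
    (hK : (interior (K : Set (Euc n))).Nonempty) :
    (interior ((minkowskiSymmetrization n).sym H K : Set (Euc n))).Nonempty := by
  obtain ⟨x, hx⟩ := hK
  obtain ⟨ε, hε, h⟩ := Metric.nhds_basis_closedBall.mem_iff.1 (mem_interior_iff_mem_nhds.1 hx)
  obtain ⟨c, hc⟩ := exists_closedBall_subset_minkowski H hε.le h
  exact ⟨c, mem_interior_iff_mem_nhds.2 (mem_of_superset (Metric.closedBall_mem_nhds c hε) hc)⟩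

theorem eventually_atTop_add {p : ℕ → Prop} (j : ℕ) (h : ∀ᶠ i in atTop, p (j + i)) :
    ∀ᶠ m in atTop, p m := by
  obtain ⟨N, hN⟩ := eventually_atTop.1 h
  refine eventually_atTop.2 ⟨j + N, fun m hm => ?_⟩
  have := hN (m - j) (by omega)
  rwa [Nat.add_sub_cancel' (by omega)] at this

theorem supportFn_le_of_tendsto {P Q : ℕ → ConvexCompact n} {c c' : Euc n} {r r' : ℝ}
    {hr : 0 ≤ r} {hr' : 0 ≤ r'} (hP : Tendsto P atTop (𝓝 (ballBody c r hr)))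
    (hQ : Tendsto Q atTop (𝓝 (ballBody c' r' hr')))
    (h : ∀ i, (P (i + 1) : Set (Euc n)) ⊆ Q i) (u : Euc n) :
    ⟪u, c⟫ + r * ‖u‖ ≤ ⟪u, c'⟫ + r' * ‖u‖ := by
  have hlim : ∀ {P : ℕ → ConvexCompact n} {K : ConvexCompact n}, Tendsto P atTop (𝓝 K) →
      Tendsto (fun i => supportFn (P i) u) atTop (𝓝 (supportFn K u)) := by
    intro P K hP
    rw [tendsto_iff_dist_tendsto_zero] at hP ⊢
    refine squeeze_zero (fun _ => dist_nonneg) (fun i => abs_supportFn_sub_le (P i) K u) ?_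
    simpa using hP.mul_const ‖u‖
  rw [← supportFn_ballBody c hr, ← supportFn_ballBody c' hr']
  exact le_of_tendsto_of_tendsto' ((tendsto_add_atTop_iff_nat 1).2 (hlim hP)) (hlim hQ)
    fun i => supportFn_mono (h i) u

theorem process_succ_eq (D : Symmetrization n) (H : ℕ → Submodule ℝ (Euc n)) (k : ℕ)
    (K : ConvexCompact n) (i : ℕ) :
    D.process H k K (i + 1) = D.process H (k + 1) (D.sym (H k) K) i := by
  have := D.process_add H k K 0 i
  rw [zero_add, add_comm 1 i] at this
  exact this

theorem convergesToBalls_minkowski_of_bodies [NeZero n] (hD : D ∈ familyF n)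
    (h : D.ConvergesToBalls H fun K => (interior (K : Set (Euc n))).Nonempty) :
    (minkowskiSymmetrization n).ConvergesToBalls H
      fun K => (interior (K : Set (Euc n))).Nonempty := by
  intro k K hK
  set M := minkowskiSymmetrization n
  set Q := M.process H k K with hQ
  have hQint : ∀ j, (interior (Q j : Set (Euc n))).Nonempty := process_induction
    (p := fun L : ConvexCompact n => (interior (L : Set (Euc n))).Nonempty) interior_minkowski_nonempty k hK
  obtain ⟨R, hR, hKR⟩ := exists_subset_closedBall K
  have hQR : ∀ j, (Q j : Set (Euc n)) ⊆ Metric.closedBall 0 R := process_induction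
    (p := fun L : ConvexCompact n => (L : Set (Euc n)) ⊆ Metric.closedBall 0 R)
    (fun H L => minkowski_subset_closedBall H hR.le) k hKR
  -- Q j has already used the subspaces with indices k, …, k + j, so D takes over at k + j + 1.
  choose c r hr hT using fun j => h (k + j + 1) (Q j) (hQint j)
  refine tendsto_ballBody_of_inner_balls hQR (c := c) (r := r) (fun j δ hδ => ?_) (fun j u => ?_)
    (fun j => radius_pos_of_tendsto_process hD (hQint j) (hT j))
    (fun j => le_volume_closedBall_of_tendsto (hr j) (hT j) (volume_le_volume_process hD _ _))
  · refine eventually_atTop_add (j + 1) ?_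
    filter_upwards [(tendsto_ballBody_iff (hr j)).1 (hT j) δ hδ] with i hi u
    refine (hi u).1.trans (supportFn_mono ?_ u)
    rw [hQ, process_add]
    exact process_subset_process isMonotone_minkowski (sym_subset_minkowski hD) _ _ _
  -- After one step of D from Q j the set lies in Q (j + 1), so the D-process from Q j, delayed by
  -- one, stays inside that from Q (j + 1).
  · refine supportFn_le_of_tendsto (hT j) (hT (j + 1)) (fun i => ?_) u
    rw [process_succ_eq]
    exact process_mono hD.1 _ (sym_subset_minkowski hD _ _) i

theorem supportFn_process_minkowski_add_ballBody (k : ℕ) (K : ConvexCompact n) (j : ℕ) (u : Euc n) :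
    supportFn ((minkowskiSymmetrization n).process H k (K + ballBody 0 1 zero_le_one) j) u =
      supportFn ((minkowskiSymmetrization n).process H k K j) u + ‖u‖ := by
  have step : ∀ (H : Submodule ℝ (Euc n)) (K L : ConvexCompact n),
      (∀ u, supportFn K u = supportFn L u + ‖u‖) → ∀ u,
      supportFn ((minkowskiSymmetrization n).sym H K) u =
        supportFn ((minkowskiSymmetrization n).sym H L) u + ‖u‖ := by
    intro H K L h u
    rw [supportFn_minkowski, supportFn_minkowski, h, h, LinearIsometryEquiv.norm_map]
    ring
  induction j generalizing u with
  | zero =>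
    refine step _ _ _ (fun u => ?_) u
    rw [supportFn_add, supportFn_ballBody, inner_zero_right, zero_add, one_mul]
  | succ j ih => exact step _ _ _ ih u

theorem convergesToBalls_minkowski [NeZero n]
    (h : (minkowskiSymmetrization n).ConvergesToBalls H
      fun K => (interior (K : Set (Euc n))).Nonempty) :
    (minkowskiSymmetrization n).ConvergesToBalls H fun _ => True := by
  intro k K _
  set L := K + ballBody (0 : Euc n) 1 zero_le_one with hL
  have hLint : (interior (L : Set (Euc n))).Nonempty := by
    obtain ⟨x, hx⟩ := K.nonempty
    refine ⟨x, mem_interior_iff_mem_nhds.2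
      (mem_of_superset (Metric.closedBall_mem_nhds x one_pos) ?_)⟩
    refine (closedBall_subset_iff zero_le_one).2 fun u => ?_
    rw [hL, supportFn_add, supportFn_ballBody, inner_zero_right, zero_add]
    exact add_le_add_left (inner_le_supportFn hx u) _
  obtain ⟨c, r, hr, hT⟩ := h k L hLint
  rw [tendsto_ballBody_iff] at hT
  have hsupp := supportFn_process_minkowski_add_ballBody (H := H) k K
  obtain ⟨e, he⟩ := exists_norm_eq_one (n := n)
  have hr1 : 0 ≤ r - 1 := by
    refine le_of_forall_pos_le_add fun ε hε => ?_
    obtain ⟨m, hm⟩ := (hT ε hε).exists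
    have h1 := (hm e).2
    have h2 := (hm (-e)).2
    obtain ⟨x, hx⟩ := ((minkowskiSymmetrization n).process H k K m).nonempty
    have h3 := inner_le_supportFn hx e
    have h4 := inner_le_supportFn hx (-e)
    rw [hsupp] at h1 h2
    simp only [norm_neg, he, inner_neg_left] at h1 h2 h3 h4
    linarith
  refine ⟨c, r - 1, hr1, (tendsto_ballBody_iff hr1).2 fun ε hε => ?_⟩
  filter_upwards [hT ε hε] with m hm u
  have := hm u
  rw [hsupp] at this
  constructor <;> linarith [this.1, this.2]

/-- Mean width replaces volume here, and M bounds the S-process from outside; neither needs K to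
have interior. -/
theorem convergesToBalls_of_minkowski [NeZero n] {S : Symmetrization n} (hS : S ∈ familyF n)
    (h : (minkowskiSymmetrization n).ConvergesToBalls H fun _ => True) :
    S.ConvergesToBalls H fun _ => True := by
  intro k K _
  set M := minkowskiSymmetrization n
  set Q := S.process H k K with hQ
  obtain ⟨R, hR, hKR⟩ := exists_subset_closedBall K
  have hQR : ∀ j, (Q j : Set (Euc n)) ⊆ Metric.closedBall 0 R := process_induction
    (p := fun L : ConvexCompact n => (L : Set (Euc n)) ⊆ Metric.closedBall 0 R)
    (fun H L => sym_subset_closedBall hS H hR.le) k hKR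
  choose c r hr hT using fun j => h (k + j + 1) (Q j) trivial
  refine tendsto_ballBody_of_outer_balls hQR (c := c) (r := r) (fun j δ hδ => ?_) (fun j u => ?_)
    hr (fun j => meanWidth_eq_of_tendsto (hr j) (hT j) (meanWidth_process_minkowski _ _))
  · refine eventually_atTop_add (j + 1) ?_
    filter_upwards [(tendsto_ballBody_iff (hr j)).1 (hT j) δ hδ] with i hi u
    refine (supportFn_mono ?_ u).trans (hi u).2
    rw [hQ, process_add]
    exact process_subset_process isMonotone_minkowski (sym_subset_minkowski hS) _ _ _
  · have hlim := (tendsto_add_atTop_iff_nat 1).2 (hT j)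
    -- The smaller M-process, from Q (j + 1), is the one that started a step later. The larger is
    -- therefore shifted by two, one for this delay and one for the shift built into
    -- `supportFn_le_of_tendsto`.
    refine supportFn_le_of_tendsto (Q := fun i => M.process H (k + j + 1) (Q j) (i + 1 + 1))
      (hT (j + 1)) ((tendsto_add_atTop_iff_nat 1).2 hlim) (fun i => ?_) u
    rw [process_succ_eq M H (k + j + 1)]
    exact process_mono isMonotone_minkowski _ (sym_subset_minkowski hS _ _) (i + 1)

theorem convergesToBalls_of_bodies [NeZero n] {S : Symmetrization n} (hD : D ∈ familyF n)
    (hS : S ∈ familyF n)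
    (h : D.ConvergesToBalls H fun K => (interior (K : Set (Euc n))).Nonempty) :
    S.ConvergesToBalls H fun _ => True :=
  convergesToBalls_of_minkowski hS
    (convergesToBalls_minkowski (convergesToBalls_minkowski_of_bodies hD h))

theorem WeaklyUniversal.of_mem_familyF [NeZero n] {S : Symmetrization n} (hD : D ∈ familyF n)
    (hS : S ∈ familyF n) (h : D.WeaklyUniversal H) : S.WeaklyUniversal H := fun k K =>
  convergesToBalls_of_bodies hD hS (fun k K _ => h k K) k K trivial

theorem WeaklyUniversalOnBodies.of_mem_familyF [NeZero n] {S : Symmetrization n}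
    (hD : D ∈ familyF n) (hS : S ∈ familyF n) (h : D.WeaklyUniversalOnBodies H) :
    S.WeaklyUniversalOnBodies H := by
  intro k K hK
  obtain ⟨c, r, hr, hT⟩ := convergesToBalls_of_bodies hD hS (fun k K hK =>
    let ⟨c, r, hr, hT⟩ := h k K hK
    ⟨c, r, hr.le, hT⟩) k K trivial
  exact ⟨c, r, radius_pos_of_tendsto_process hS hK hT, hT⟩

end Symmetrization

theorem convexCompact_zero_subsingleton : Subsingleton (ConvexCompact 0) :=
  ⟨fun K L => ConvexBody.ext <| by
    rw [Set.Nonempty.eq_univ K.nonempty, Set.Nonempty.eq_univ L.nonempty]⟩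

end Convergence

theorem mainTheorem3 (n : ℕ) (D S : Symmetrization n)
    (hD : D ∈ Symmetrization.familyF n) (hS : S ∈ Symmetrization.familyF n)
    (H : ℕ → Submodule ℝ (Euc n)) :
    (D.WeaklyUniversal H ↔ S.WeaklyUniversal H) ∧
      (D.WeaklyUniversalOnBodies H ↔ S.WeaklyUniversalOnBodies H) := by
  -- In dimension 0 there is a single convex body, so all processes coincide; the general argument
  -- needs unit vectors and 0^n = 0.
  rcases n.eq_zero_or_pos with rfl | hn
  · have := convexCompact_zero_subsingleton
    have e : D.process H = S.process H := Subsingleton.elim _ _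
    simp only [Symmetrization.WeaklyUniversal, Symmetrization.WeaklyUniversalOnBodies, e, and_self]
  · have : NeZero n := ⟨hn.ne'⟩
    exact ⟨⟨fun h => h.of_mem_familyF hD hS, fun h => h.of_mem_familyF hS hD⟩,
      ⟨fun h => h.of_mem_familyF hD hS, fun h => h.of_mem_familyF hS hD⟩⟩
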